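/- Let $\mathbb O=\mathbb H\oplus\mathbb H$ be the algebra of Cayley numbers, with product $(q_1,q_2)(s_1,s_2)=(q_1s_1-\overline{s_2}q_2,\;s_2q_1+q_2\overline{s_1})$ and its Euclidean inner product. Let $\mathrm{Spin}(7)$ be the group of all triples $(A,B,C)\in \mathrm{SO}(8)^3$ with $A(x)B(y)=C(xy)$ for all $x,y\in\mathbb O$ and $A(1)=1$. It acts on the unit sphere $S^7\subset\mathbb O$ by $(A,B,C)\cdot p=B(p)$; the action is transitive and the stabilizer of $1$ is $G_2=\mathrm{Aut}(\mathbb O)$, so that $S^7=\mathrm{Spin}(7)/G_2$. A Finsler metric on $S^7$ is a continuous function $F:TS^7\to[0,\infty)$, smooth off the zero section, such that $F(x,y)>0$ for $y\neq0$, $F(x,\lambda y)=\lambda F(x,y)$ for $\lambda>0$, and the Hessian of $\tfrac12F^2(x,\cdot)$ is positive definite at every nonzero tangent vector. Proposition. Let $F$ be a $\mathrm{Spin}(7)$-invariant Finsler metric on $S^7=\mathrm{Spin}(7)/G_2$. Suppose that there is a nonzero $X\in\mathrm{Lie}(\mathrm{Spin}(7))$ whose fundamental vector field $X^*_p=\frac{d}{dt}\big|_{t=0}\exp(tX)\cdot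 p$ (a Killing vector field of $F$) has constant length, i.e. $p\mapsto F(p,X^*_p)$ is constant. Then $F$ is a symmetric Riemannian metric: $F$ is the norm of a smooth Riemannian metric, every point of $S^7$ is an isolated fixed point of an involutive isometry of $(S^7,F)$, and $F$ is a positive constant multiple of the norm of the standard round metric of the unit sphere $S^7\subset\mathbb O$. -/

import Mathlib

open scoped Manifold ContDiff Quaternion

noncomputable section

namespace FinslerSphere

/-! ### Finsler metrics -/

section Finsler

variable {n : ℕ} (M : Type*) [TopologicalSpace M] [ChartedSpace (EuclideanSpace ℝ (Fin n)) M]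
  [IsManifold (𝓡 n) ∞ M]

/-- Half of the second derivative of `f ^ 2` at `v` in the directions `u`, `w`:
`(1 / 2) ∂² / ∂s ∂t [f ^ 2 (v + s u + t w)]` at `s = t = 0`. For a Finsler metric and `f` its
restriction to a tangent space this is the fundamental tensor `g_{ij}(v) u^i w^j`. -/
def fundamentalTensor {V : Type*} [AddCommGroup V] [Module ℝ V] (f : V → ℝ) (v u w : V) : ℝ :=
  (1 / 2) * deriv (fun s : ℝ => deriv (fun t : ℝ => f (v + s • u + t • w) ^ 2) 0) 0

/-- A (not necessarily reversible) Finsler metric on a smooth manifold `M` of dimension `n`. -/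
structure FinslerMetric where
  /-- the function `F` on the tangent bundle -/
  toFun : TangentBundle (𝓡 n) M → ℝ
  continuous_toFun : Continuous toFun
  smooth_toFun : ContMDiffOn (𝓡 n).tangent 𝓘(ℝ, ℝ) ∞ toFun {v | v.2 ≠ 0}
  pos : ∀ (p : M) (v : TangentSpace (𝓡 n) p), v ≠ 0 → 0 < toFun ⟨p, v⟩
  homogeneous : ∀ (p : M) (v : TangentSpace (𝓡 n) p) (r : ℝ), 0 < r →
    toFun ⟨p, r • v⟩ = r * toFun ⟨p, v⟩
  convex : ∀ (p : M) (v : TangentSpace (𝓡 n) p), v ≠ 0 → ∀ w : TangentSpace (𝓡 n) p, w ≠ 0 →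
    0 < fundamentalTensor (fun y : TangentSpace (𝓡 n) p => toFun ⟨p, y⟩) v w w

variable {M}

/-- The map `φ` preserves `F`: `F (dφ v) = F v` for every tangent vector `v`. -/
def FinslerMetric.PreservedBy (F : FinslerMetric (n := n) M) (φ : M → M) : Prop :=
  ∀ v : TangentBundle (𝓡 n) M, F.toFun (tangentMap (𝓡 n) (𝓡 n) φ v) = F.toFun v

/-- `F` is the norm of a smooth Riemannian metric. -/
def FinslerMetric.IsRiemannian (F : FinslerMetric (n := n) M) : Prop :=
  ∃ g : Bundle.ContMDiffRiemannianMetric (𝓡 n) ∞ (EuclideanSpace ℝ (Fin n))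
      (fun p : M => TangentSpace (𝓡 n) p),
    ∀ (p : M) (v : TangentSpace (𝓡 n) p), F.toFun ⟨p, v⟩ = Real.sqrt (g.inner p v v)

/-- `(M, F)` is (globally) symmetric: every point is an isolated fixed point of an involutive
isometry. -/
def FinslerMetric.IsSymmetric (F : FinslerMetric (n := n) M) : Prop :=
  ∀ p : M, ∃ σ : M ≃ₘ⟮𝓡 n, 𝓡 n⟯ M, F.PreservedBy σ ∧ (∀ q, σ (σ q) = q) ∧ σ p = p ∧
    ∀ᶠ q in nhdsWithin p {p}ᶜ, σ q ≠ q

end Finsler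

/-! ### Cayley numbers -/

/-- The Cayley numbers `ℍ ⊕ ℍ`, with the Euclidean inner product. -/
def Cayley : Type := WithLp 2 (ℍ[ℝ] × ℍ[ℝ])

instance : NormedAddCommGroup Cayley := inferInstanceAs (NormedAddCommGroup (WithLp 2 (ℍ[ℝ] × ℍ[ℝ])))

instance : InnerProductSpace ℝ Cayley :=
  inferInstanceAs (InnerProductSpace ℝ (WithLp 2 (ℍ[ℝ] × ℍ[ℝ])))

instance : FiniteDimensional ℝ Cayley :=
  inferInstanceAs (FiniteDimensional ℝ (WithLp 2 (ℍ[ℝ] × ℍ[ℝ])))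

/-- The multiplication
`(q₁, q₂) (s₁, s₂) = (q₁ s₁ - conj s₂ * q₂, s₂ q₁ + q₂ * conj s₁)` of Cayley numbers. -/
def cmul (x y : Cayley) : Cayley :=
  WithLp.toLp 2 (x.fst * y.fst - star y.snd * x.snd, y.snd * x.fst + x.snd * star y.fst)

/-- The unit `1 = (1, 0)` of the Cayley numbers. -/
def cone : Cayley := WithLp.toLp 2 (1, 0)

instance : Fact (Module.finrank ℝ Cayley = 7 + 1) :=
  ⟨by
    change Module.finrank ℝ (WithLp 2 (ℍ[ℝ] × ℍ[ℝ])) = 7 + 1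
    rw [LinearEquiv.finrank_eq (WithLp.linearEquiv 2 ℝ (ℍ[ℝ] × ℍ[ℝ])), Module.finrank_prod,
      Quaternion.finrank_eq_four]⟩

/-- The unit sphere `S⁷` of the Cayley numbers, with Mathlib's smooth structure. -/
abbrev S7 : Type := Metric.sphere (0 : Cayley) 1

/-! ### The groups -/

/-- The special orthogonal group of the eight-dimensional Euclidean space of Cayley numbers. -/
def SO8 : Subgroup (Cayley ≃ₗᵢ[ℝ] Cayley) where
  carrier := {A | LinearMap.det (A.toLinearEquiv : Cayley →ₗ[ℝ] Cayley) = 1}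
  one_mem' := LinearMap.det_id
  mul_mem' := by
    intro A B hA hB
    have h : ((A * B).toLinearEquiv : Cayley →ₗ[ℝ] Cayley) =
        (A.toLinearEquiv : Cayley →ₗ[ℝ] Cayley) * (B.toLinearEquiv : Cayley →ₗ[ℝ] Cayley) := rfl
    simp only [Set.mem_ofPred_eq] at hA hB ⊢
    rw [h, map_mul, hA, hB, one_mul]
  inv_mem' := by
    intro A hA
    have h : ((A⁻¹).toLinearEquiv : Cayley →ₗ[ℝ] Cayley) *
        (A.toLinearEquiv : Cayley →ₗ[ℝ] Cayley) = 1 := by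
      ext1 x
      exact A.symm_apply_apply x
    have h2 := congrArg LinearMap.det h
    simp only [Set.mem_ofPred_eq] at hA ⊢
    rw [map_mul, hA, mul_one, map_one] at h2
    exact h2

/-- `Spin(8)`: the group of triality triples `(A, B, C)`, `A(x) B(y) = C(xy)`. -/
def spin8 : Subgroup (SO8 × SO8 × SO8) where
  carrier := {g | ∀ x y : Cayley, cmul (g.1.1 x) (g.2.1.1 y) = g.2.2.1 (cmul x y)}
  one_mem' := fun _ _ => rfl
  mul_mem' := by
    intro g h hg hh x y
    exact (hg (h.1.1 x) (h.2.1.1 y)).trans (congrArg g.2.2.1 (hh x y))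
  inv_mem' := by
    intro g hg x y
    have h := hg (g.1.1.symm x) (g.2.1.1.symm y)
    rw [LinearIsometryEquiv.apply_symm_apply, LinearIsometryEquiv.apply_symm_apply] at h
    exact ((LinearIsometryEquiv.eq_symm_apply g.2.2.1).2 h.symm)

/-- `Spin(7)`: the triality triples `(A, B, C)` with `A(1) = 1`. -/
def spin7 : Subgroup (SO8 × SO8 × SO8) where
  carrier := {g | g ∈ spin8 ∧ g.1.1 cone = cone}
  one_mem' := ⟨spin8.one_mem, rfl⟩
  mul_mem' := by
    intro g h hg hh
    exact ⟨spin8.mul_mem hg.1 hh.1, (congrArg g.1.1 hh.2).trans hg.2⟩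
  inv_mem' := by
    intro g hg
    exact ⟨spin8.inv_mem hg.1, (LinearIsometryEquiv.symm_apply_eq g.1.1).2 hg.2.symm⟩

/-- The action of `Spin(7)` on `S⁷` by `(A, B, C) • p = B(p)`. It is transitive, and the stabilizer
of `1` is the subgroup `A = B = C`, which is `G₂`, the automorphism group of the Cayley numbers;
this is the identification `S⁷ = Spin(7) / G₂`. -/
instance : MulAction spin7 S7 where
  smul g p := ⟨g.1.2.1.1 p, by
    have hp : ‖(p : Cayley)‖ = 1 := mem_sphere_zero_iff_norm.1 p.2
    rw [mem_sphere_zero_iff_norm, LinearIsometryEquiv.norm_map, hp]⟩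
  one_smul _ := rfl
  mul_smul _ _ _ := rfl

/-! ### The Lie algebra and its fundamental vector fields -/

/-- The linear endomorphism of the Cayley numbers underlying an element of `SO(8)`. -/
def SO8.toEnd (A : SO8) : Cayley →L[ℝ] Cayley := (A.1.toContinuousLinearEquiv : Cayley →L[ℝ] Cayley)

/-- The Lie algebra of the linear group `Spin(7)`: the triples `(X₁, X₂, X₃)` of endomorphisms such
that `exp (tX) = (exp (tX₁), exp (tX₂), exp (tX₃))` belongs to `Spin(7)` for all real `t`. -/
def lieSpin7 : Set ((Cayley →L[ℝ] Cayley) × (Cayley →L[ℝ] Cayley) × (Cayley →L[ℝ] Cayley)) :=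
  {X | ∀ t : ℝ, ∃ g : spin7, SO8.toEnd g.1.1 = NormedSpace.exp (t • X.1) ∧
    SO8.toEnd g.1.2.1 = NormedSpace.exp (t • X.2.1) ∧
    SO8.toEnd g.1.2.2 = NormedSpace.exp (t • X.2.2)}

/-- The element `exp (tX)` of `Spin(7)`; it is determined by its three components. -/
def expSpin7 (X : lieSpin7) (t : ℝ) : spin7 := Classical.choose (X.2 t)

/-- The value at `p` of the fundamental vector field of `X ∈ Lie(Spin(7))` on `S⁷`:
the velocity at `t = 0` of the curve `exp (tX) • p` (a tangent vector based at `p`). -/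
def fundamentalVector (X : lieSpin7) (p : S7) : TangentBundle (𝓡 7) S7 :=
  tangentMap 𝓘(ℝ, ℝ) (𝓡 7) (fun t : ℝ => expSpin7 X t • p) ⟨0, (1 : ℝ)⟩

/-- The Euclidean length of a tangent vector of the unit sphere `S⁷`: the norm of the standard
round metric. -/
def roundNorm (v : TangentBundle (𝓡 7) S7) : ℝ :=
  ‖(show Cayley from (tangentMap (𝓡 7) 𝓘(ℝ, Cayley) (fun q : S7 => (q : Cayley)) v).2)‖

end FinslerSphere

end

noncomputable section

namespace FinslerSphere

/-! ### Algebra of the Cayley numbers -/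

open scoped InnerProductSpace
open Bundle

/-! `Spin(7)` is transitive on the unit tangent vectors of the round sphere, that is, on orthonormal
pairs (p, v) in the Cayley numbers (`exists_spin7_apply_orthonormal`). An invariant F is therefore
constant on these vectors, and positive homogeneity makes it a constant multiple of the round norm
(`FinslerMetric.exists_eq_mul_roundNorm`). The round metric gives the Riemannian property, and the
reflections in the lines through the points of the sphere are the symmetries.

Transitivity uses only left multiplications L_u by imaginary units, which lie in `Spin(7)` by the
Moufang identity (`spin7OfImaginary`). A product of two of them takes 1 to any given p
(`exists_spin7_apply_cone`). A product of three, L_{cb} L_b L_c, fixes 1 and c and negates suitable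
n (`exists_spin7_reflection`); with c along v + w and n = v - w it takes v to w
(`exists_spin7_fix_cone_apply`). -/

theorem Cayley.ext_components {x y : Cayley} (h₁ : x.fst = y.fst) (h₂ : x.snd = y.snd) : x = y :=
  WithLp.ofLp_injective 2 (Prod.ext h₁ h₂)

theorem fst_cmul (x y : Cayley) : (cmul x y).fst = x.fst * y.fst - star y.snd * x.snd := rfl
theorem snd_cmul (x y : Cayley) : (cmul x y).snd = y.snd * x.fst + x.snd * star y.fst := rfl
theorem Cayley.fst_add (x y : Cayley) : (x + y).fst = x.fst + y.fst := rfl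
theorem Cayley.snd_add (x y : Cayley) : (x + y).snd = x.snd + y.snd := rfl
theorem Cayley.fst_sub (x y : Cayley) : (x - y).fst = x.fst - y.fst := rfl
theorem Cayley.snd_sub (x y : Cayley) : (x - y).snd = x.snd - y.snd := rfl
theorem Cayley.fst_neg (x : Cayley) : (-x).fst = -x.fst := rfl
theorem Cayley.snd_neg (x : Cayley) : (-x).snd = -x.snd := rfl
theorem Cayley.fst_smul (r : ℝ) (x : Cayley) : (r • x).fst = r • x.fst := rfl
theorem Cayley.snd_smul (r : ℝ) (x : Cayley) : (r • x).snd = r • x.snd := rfl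
theorem fst_cone : cone.fst = 1 := rfl
theorem snd_cone : cone.snd = 0 := rfl

theorem Cayley.inner_eq (x y : Cayley) :
    ⟪x, y⟫_ℝ = (x.fst * star y.fst).re + (x.snd * star y.snd).re := by
  rw [← Quaternion.inner_def, ← Quaternion.inner_def]; rfl

theorem inner_cone_left (x : Cayley) : ⟪cone, x⟫_ℝ = x.fst.re := by
  simp [Cayley.inner_eq, fst_cone, snd_cone]

theorem norm_cone : ‖cone‖ = 1 := by
  have h : ‖cone‖ ^ 2 = 1 := by
    rw [← real_inner_self_eq_norm_sq, inner_cone_left]; rfl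
  exact (pow_eq_one_iff_of_nonneg (norm_nonneg _) two_ne_zero).1 h

theorem cmul_add (x y z : Cayley) : cmul x (y + z) = cmul x y + cmul x z := by
  apply Cayley.ext_components <;>
    simp only [fst_cmul, snd_cmul, Cayley.fst_add, Cayley.snd_add, star_add, mul_add, add_mul] <;>
    abel

theorem add_cmul (x y z : Cayley) : cmul (x + y) z = cmul x z + cmul y z := by
  apply Cayley.ext_components <;>
    simp only [fst_cmul, snd_cmul, Cayley.fst_add, Cayley.snd_add, mul_add, add_mul] <;>
    abel

theorem cmul_smul (r : ℝ) (x y : Cayley) : cmul x (r • y) = r • cmul x y := by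
  apply Cayley.ext_components <;>
    simp [fst_cmul, snd_cmul, Cayley.fst_smul, Cayley.snd_smul, smul_sub]

theorem smul_cmul (r : ℝ) (x y : Cayley) : cmul (r • x) y = r • cmul x y := by
  apply Cayley.ext_components <;>
    simp [fst_cmul, snd_cmul, Cayley.fst_smul, Cayley.snd_smul, smul_sub]

theorem neg_cmul (x y : Cayley) : cmul (-x) y = -cmul x y := by
  simpa using smul_cmul (-1) x y

theorem cmul_neg (x y : Cayley) : cmul x (-y) = -cmul x y := by
  simpa using cmul_smul (-1) x y

theorem cmul_cone (x : Cayley) : cmul x cone = x := by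
  apply Cayley.ext_components <;> simp [fst_cmul, snd_cmul, fst_cone, snd_cone]

theorem inner_cmul_self (x y : Cayley) : ⟪cmul x y, cmul x y⟫_ℝ = ⟪x, x⟫_ℝ * ⟪y, y⟫_ℝ := by
  simp only [Cayley.inner_eq, fst_cmul, snd_cmul, Quaternion.re_mul, Quaternion.imI_mul,
    Quaternion.imJ_mul, Quaternion.imK_mul, Quaternion.re_star, Quaternion.imI_star,
    Quaternion.imJ_star, Quaternion.imK_star, Quaternion.re_add, Quaternion.imI_add,
    Quaternion.imJ_add, Quaternion.imK_add, Quaternion.re_sub, Quaternion.imI_sub,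
    Quaternion.imJ_sub, Quaternion.imK_sub]
  ring

theorem norm_cmul (x y : Cayley) : ‖cmul x y‖ = ‖x‖ * ‖y‖ := by
  have h := inner_cmul_self x y
  simp only [real_inner_self_eq_norm_sq, ← mul_pow] at h
  exact (pow_left_inj₀ (norm_nonneg _) (by positivity) two_ne_zero).1 h

/-- The Moufang identity. -/
theorem moufang (u x y : Cayley) :
    cmul (cmul (cmul u x) u) y = cmul u (cmul x (cmul u y)) := by
  apply Cayley.ext_components <;> ext <;>
  simp only [fst_cmul, snd_cmul, Quaternion.re_mul, Quaternion.imI_mul,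
    Quaternion.imJ_mul, Quaternion.imK_mul, Quaternion.re_star, Quaternion.imI_star,
    Quaternion.imJ_star, Quaternion.imK_star, Quaternion.re_add, Quaternion.imI_add,
    Quaternion.imJ_add, Quaternion.imK_add, Quaternion.re_sub, Quaternion.imI_sub,
    Quaternion.imJ_sub, Quaternion.imK_sub] <;>
  ring

/-- The Clifford relation, the polarization of a(ay) = -|a|²y for imaginary a. -/
theorem cmul_cmul_add_swap {a b : Cayley} (ha : ⟪cone, a⟫_ℝ = 0) (hb : ⟪cone, b⟫_ℝ = 0)
    (y : Cayley) : cmul a (cmul b y) + cmul b (cmul a y) = (-2 * ⟪a, b⟫_ℝ) • y := by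
  rw [inner_cone_left] at ha hb
  apply Cayley.ext_components <;> ext <;>
  simp only [ha, hb, Cayley.inner_eq, fst_cmul, snd_cmul, Quaternion.re_mul, Quaternion.imI_mul,
    Quaternion.imJ_mul, Quaternion.imK_mul, Quaternion.re_star, Quaternion.imI_star,
    Quaternion.imJ_star, Quaternion.imK_star, Quaternion.re_add, Quaternion.imI_add,
    Quaternion.imJ_add, Quaternion.imK_add, Quaternion.re_sub, Quaternion.imI_sub,
    Quaternion.imJ_sub, Quaternion.imK_sub, Cayley.fst_add, Cayley.snd_add, Cayley.fst_smul,
    Cayley.snd_smul, Quaternion.re_smul, Quaternion.imI_smul, Quaternion.imJ_smul,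
    Quaternion.imK_smul, smul_eq_mul] <;>
  ring

theorem cmul_cmul_add_swap_right {a b : Cayley} (ha : ⟪cone, a⟫_ℝ = 0) (hb : ⟪cone, b⟫_ℝ = 0)
    (y : Cayley) : cmul (cmul y a) b + cmul (cmul y b) a = (-2 * ⟪a, b⟫_ℝ) • y := by
  rw [inner_cone_left] at ha hb
  apply Cayley.ext_components <;> ext <;>
  simp only [ha, hb, Cayley.inner_eq, fst_cmul, snd_cmul, Quaternion.re_mul, Quaternion.imI_mul,
    Quaternion.imJ_mul, Quaternion.imK_mul, Quaternion.re_star, Quaternion.imI_star,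
    Quaternion.imJ_star, Quaternion.imK_star, Quaternion.re_add, Quaternion.imI_add,
    Quaternion.imJ_add, Quaternion.imK_add, Quaternion.re_sub, Quaternion.imI_sub,
    Quaternion.imJ_sub, Quaternion.imK_sub, Cayley.fst_add, Cayley.snd_add, Cayley.fst_smul,
    Cayley.snd_smul, Quaternion.re_smul, Quaternion.imI_smul, Quaternion.imJ_smul,
    Quaternion.imK_smul, smul_eq_mul] <;>
  ring

/-- Right alternativity in polarized form; it replaces the missing associativity in
`exists_spin7_reflection`. -/
theorem associator_swap (x y z : Cayley) :
    cmul (cmul x y) z - cmul x (cmul y z) = -(cmul (cmul x z) y - cmul x (cmul z y)) := by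
  apply Cayley.ext_components <;> ext <;>
  simp only [fst_cmul, snd_cmul, Quaternion.re_mul, Quaternion.imI_mul,
    Quaternion.imJ_mul, Quaternion.imK_mul, Quaternion.re_star, Quaternion.imI_star,
    Quaternion.imJ_star, Quaternion.imK_star, Quaternion.re_add, Quaternion.imI_add,
    Quaternion.imJ_add, Quaternion.imK_add, Quaternion.re_sub, Quaternion.imI_sub,
    Quaternion.imJ_sub, Quaternion.imK_sub, Cayley.fst_sub, Cayley.snd_sub, Cayley.fst_neg,
    Cayley.snd_neg, Quaternion.re_neg, Quaternion.imI_neg, Quaternion.imJ_neg,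
    Quaternion.imK_neg] <;>
  ring

/-- Left multiplication by an imaginary Cayley number is skew-adjoint. -/
theorem inner_cmul_left {a : Cayley} (ha : ⟪cone, a⟫_ℝ = 0) (x y : Cayley) :
    ⟪cmul a x, y⟫_ℝ = -⟪x, cmul a y⟫_ℝ := by
  rw [inner_cone_left] at ha
  simp only [ha, Cayley.inner_eq, fst_cmul, snd_cmul, Quaternion.re_mul, Quaternion.imI_mul,
    Quaternion.imJ_mul, Quaternion.imK_mul, Quaternion.re_star, Quaternion.imI_star,
    Quaternion.imJ_star, Quaternion.imK_star, Quaternion.re_add, Quaternion.imI_add,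
    Quaternion.imJ_add, Quaternion.imK_add, Quaternion.re_sub, Quaternion.imI_sub,
    Quaternion.imJ_sub, Quaternion.imK_sub]
  ring

theorem cmul_cmul_self {a : Cayley} (ha : ⟪cone, a⟫_ℝ = 0) (hn : ‖a‖ = 1) (y : Cayley) :
    cmul a (cmul a y) = -y := by
  have h := cmul_cmul_add_swap ha ha y
  rw [real_inner_self_eq_norm_sq, hn] at h
  have h2 : (2 : ℝ) • cmul a (cmul a y) = (2 : ℝ) • (-y) := by
    rw [two_smul, h]; module
  exact smul_right_injective Cayley (two_ne_zero (α := ℝ)) h2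

theorem cmul_cmul_self_right {a : Cayley} (ha : ⟪cone, a⟫_ℝ = 0) (hn : ‖a‖ = 1) (y : Cayley) :
    cmul (cmul y a) a = -y := by
  have h := cmul_cmul_add_swap_right ha ha y
  rw [real_inner_self_eq_norm_sq, hn] at h
  have h2 : (2 : ℝ) • cmul (cmul y a) a = (2 : ℝ) • (-y) := by
    rw [two_smul, h]; module
  exact smul_right_injective Cayley (two_ne_zero (α := ℝ)) h2

theorem cmul_anticomm {a b : Cayley} (ha : ⟪cone, a⟫_ℝ = 0) (hb : ⟪cone, b⟫_ℝ = 0)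
    (hab : ⟪a, b⟫_ℝ = 0) : cmul a b = -cmul b a := by
  have h := cmul_cmul_add_swap ha hb cone
  rw [hab, cmul_cone, cmul_cone, mul_zero, zero_smul] at h
  exact eq_neg_of_add_eq_zero_left h

theorem cmul_cmul_anticomm {a b : Cayley} (ha : ⟪cone, a⟫_ℝ = 0) (hb : ⟪cone, b⟫_ℝ = 0)
    (hab : ⟪a, b⟫_ℝ = 0) (y : Cayley) : cmul a (cmul b y) = -cmul b (cmul a y) := by
  have h := cmul_cmul_add_swap ha hb y
  rw [hab, mul_zero, zero_smul] at h
  exact eq_neg_of_add_eq_zero_left h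

theorem inner_cone_cmul {a b : Cayley} (ha : ⟪cone, a⟫_ℝ = 0) (hab : ⟪a, b⟫_ℝ = 0) :
    ⟪cone, cmul a b⟫_ℝ = 0 := by
  have h := inner_cmul_left ha cone b
  rw [cmul_cone, hab] at h
  linarith

/-! ### Left multiplications belong to `Spin(7)` -/

theorem det_eq_one_of_isometry_of_sq_eq_neg (J : Cayley ≃ₗᵢ[ℝ] Cayley) (hJ : ∀ x, J (J x) = -x) :
    LinearMap.det (J.toLinearEquiv : Cayley →ₗ[ℝ] Cayley) = 1 := by
  set T : Cayley →ₗ[ℝ] Cayley := (J.toLinearEquiv : Cayley →ₗ[ℝ] Cayley) with hT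
  have hTx : ∀ x, T x = J x := fun _ => rfl
  -- Since J² = -1, (1 + J)² = 2J, so J is a square and its determinant is nonnegative. Its square
  -- is det(-1) = (-1)⁸ = 1.
  have hsq : T = ((√2)⁻¹ • (1 + T)) * ((√2)⁻¹ • (1 + T)) := by
    have h2 : (√2)⁻¹ * (√2)⁻¹ = (2 : ℝ)⁻¹ := by
      rw [← mul_inv, Real.mul_self_sqrt zero_le_two]
    ext1 x
    rw [smul_mul_smul_comm, h2]
    simp only [LinearMap.smul_apply, Module.End.mul_apply, LinearMap.add_apply,
      Module.End.one_apply, map_add, hTx, hJ]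
    module
  have h0 : 0 ≤ LinearMap.det T := by
    rw [hsq, map_mul]; exact mul_self_nonneg _
  have h1 : LinearMap.det T * LinearMap.det T = 1 := by
    rw [← map_mul]
    have : T * T = (-1 : ℝ) • LinearMap.id := by
      ext1 x
      simp [hTx, hJ]
    rw [this, LinearMap.det_smul, LinearMap.det_id,
      (Fact.out : Module.finrank ℝ Cayley = 7 + 1)]
    norm_num
  nlinarith

/-- Left multiplication by an imaginary unit. -/
def leftMul (u : Cayley) (hu : ⟪cone, u⟫_ℝ = 0) (hn : ‖u‖ = 1) : Cayley ≃ₗᵢ[ℝ] Cayley where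
  toFun := cmul u
  invFun y := -cmul u y
  map_add' := cmul_add u
  map_smul' r := cmul_smul r u
  left_inv y := by simp [cmul_cmul_self hu hn]
  right_inv y := by simp [cmul_neg, cmul_cmul_self hu hn]
  norm_map' y := by
    change ‖cmul u y‖ = ‖y‖
    rw [norm_cmul, hn, one_mul]

/-- Right multiplication by an imaginary unit. -/
def rightMul (u : Cayley) (hu : ⟪cone, u⟫_ℝ = 0) (hn : ‖u‖ = 1) : Cayley ≃ₗᵢ[ℝ] Cayley where
  toFun y := cmul y u
  invFun y := -cmul y u
  map_add' y z := add_cmul y z u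
  map_smul' r y := smul_cmul r y u
  left_inv y := by simp [cmul_cmul_self_right hu hn]
  right_inv y := by simp [neg_cmul, cmul_cmul_self_right hu hn]
  norm_map' y := by
    change ‖cmul y u‖ = ‖y‖
    rw [norm_cmul, hn, mul_one]

theorem leftMul_mem_SO8 {u : Cayley} (hu : ⟪cone, u⟫_ℝ = 0) (hn : ‖u‖ = 1) :
    leftMul u hu hn ∈ SO8 :=
  det_eq_one_of_isometry_of_sq_eq_neg _ (cmul_cmul_self hu hn)

theorem rightMul_mem_SO8 {u : Cayley} (hu : ⟪cone, u⟫_ℝ = 0) (hn : ‖u‖ = 1) :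
    rightMul u hu hn ∈ SO8 :=
  det_eq_one_of_isometry_of_sq_eq_neg _ (cmul_cmul_self_right hu hn)

/-- The element of `Spin(7)` acting on `S⁷` by left multiplication with an imaginary unit `u`; its
first component is the conjugation `x ↦ (u x) u⁻¹`. -/
def spin7OfImaginary (u : Cayley) (hu : ⟪cone, u⟫_ℝ = 0) (hn : ‖u‖ = 1) : spin7 :=
  ⟨((⟨rightMul u hu hn, rightMul_mem_SO8 hu hn⟩ : SO8)⁻¹ * ⟨leftMul u hu hn, leftMul_mem_SO8 hu hn⟩,
    ⟨leftMul u hu hn, leftMul_mem_SO8 hu hn⟩, ⟨leftMul u hu hn, leftMul_mem_SO8 hu hn⟩), by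
    constructor
    · intro x y
      change cmul (-cmul (cmul u x) u) (cmul u y) = cmul u (cmul x y)
      -- -((ux)u)(uy) = -u(x(u(uy))) = u(xy), by Moufang and u(uy) = -y.
      rw [neg_cmul, moufang, cmul_cmul_self hu hn, cmul_neg, cmul_neg, neg_neg]
    · change -cmul (cmul u cone) u = cone
      have h := cmul_cmul_self hu hn cone
      rw [cmul_cone] at h ⊢
      rw [h, neg_neg]⟩

/-! ### `Spin(7)` is transitive on orthonormal pairs -/

theorem exists_unit_orthogonal (s : Finset Cayley) (hs : s.card < 8) :
    ∃ b : Cayley, ‖b‖ = 1 ∧ ∀ x ∈ s, ⟪x, b⟫_ℝ = 0 := by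
  have hlt : Module.finrank ℝ (Submodule.span ℝ (s : Set Cayley)) < 8 :=
    (finrank_span_finset_le_card s).trans_lt hs
  have hne : (Submodule.span ℝ (s : Set Cayley))ᗮ ≠ ⊥ := by
    intro h
    rw [Submodule.orthogonal_eq_bot_iff] at h
    rw [h, finrank_top, (Fact.out : Module.finrank ℝ Cayley = 7 + 1)] at hlt
    omega
  obtain ⟨z, hz, hz0⟩ := Submodule.exists_mem_ne_zero_of_ne_bot hne
  refine ⟨‖z‖⁻¹ • z, by rw [norm_smul, norm_inv, norm_norm, inv_mul_cancel₀ (norm_ne_zero_iff.2 hz0)],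
    fun x hx => ?_⟩
  rw [inner_smul_right, (Submodule.mem_orthogonal _ z).1 hz x (Submodule.subset_span hx), mul_zero]

theorem exists_spin7_apply_cone {p : Cayley} (hp : ‖p‖ = 1) :
    ∃ g : spin7, g.1.2.1.1 cone = p := by
  classical
  obtain ⟨b, hb, hbs⟩ := exists_unit_orthogonal {cone, p} (Finset.card_le_two.trans_lt (by norm_num))
  have hb0 : ⟪cone, b⟫_ℝ = 0 := hbs _ (by simp)
  have hpb : ⟪p, b⟫_ℝ = 0 := hbs _ (by simp)
  -- As b is imaginary, Re(pb) = -⟪p, b⟫ = 0, so -pb is an imaginary unit; the witness then works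
  -- because -(pb)b = p.
  have h1 : ⟪cone, -cmul p b⟫_ℝ = 0 := by
    rw [inner_neg_right, neg_eq_zero, inner_cone_left]
    rw [inner_cone_left] at hb0
    simp only [Cayley.inner_eq, fst_cmul, hb0, Quaternion.re_mul, Quaternion.re_star,
      Quaternion.imI_star, Quaternion.imJ_star, Quaternion.imK_star, Quaternion.re_sub] at hpb ⊢
    linarith
  have h2 : ‖-cmul p b‖ = 1 := by rw [norm_neg, norm_cmul, hp, hb, one_mul]
  refine ⟨spin7OfImaginary _ h1 h2 * spin7OfImaginary b hb0 hb, ?_⟩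
  change cmul (-cmul p b) (cmul b cone) = p
  rw [cmul_cone, neg_cmul, cmul_cmul_self_right hb0 hb, neg_neg]

/-- The reflection in the quaternion subalgebra spanned by `1, c, b, c b`. -/
theorem exists_spin7_reflection {b c n : Cayley} (hb : ⟪cone, b⟫_ℝ = 0) (hc : ⟪cone, c⟫_ℝ = 0)
    (hn : ⟪cone, n⟫_ℝ = 0) (hb1 : ‖b‖ = 1) (hc1 : ‖c‖ = 1) (hcb : ⟪c, b⟫_ℝ = 0)
    (hcn : ⟪c, n⟫_ℝ = 0) (hnb : ⟪n, b⟫_ℝ = 0) (hcnb : ⟪cmul c n, b⟫_ℝ = 0) :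
    ∃ g : spin7, g.1.2.1.1 cone = cone ∧ g.1.2.1.1 c = c ∧ g.1.2.1.1 n = -n := by
  have ha : ⟪cone, cmul c b⟫_ℝ = 0 := inner_cone_cmul hc hcb
  have ha1 : ‖cmul c b‖ = 1 := by rw [norm_cmul, hb1, hc1, one_mul]
  refine ⟨spin7OfImaginary _ ha ha1 * (spin7OfImaginary b hb hb1 * spin7OfImaginary c hc hc1),
    ?_, ?_, ?_⟩
  · change cmul (cmul c b) (cmul b (cmul c cone)) = cone
    have h := cmul_cmul_self ha ha1 cone
    rw [cmul_cone] at h ⊢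
    rw [cmul_anticomm hb hc (by rw [real_inner_comm, hcb]), cmul_neg, h, neg_neg]
  · change cmul (cmul c b) (cmul b (cmul c c)) = c
    have h := cmul_cmul_self hc hc1 cone
    rw [cmul_cone] at h
    rw [h, cmul_neg, cmul_neg, cmul_cone, cmul_cmul_self_right hb hb1, neg_neg]
  · change cmul (cmul c b) (cmul b (cmul c n)) = -n
    have h1 : cmul b (cmul c n) = -cmul c (cmul b n) :=
      cmul_cmul_anticomm hb hc (by rw [real_inner_comm, hcb]) n
    have h2 : cmul n b = -cmul b n := cmul_anticomm hn hb hnb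
    have h3 : cmul (cmul c n) b = -cmul b (cmul c n) :=
      cmul_anticomm (inner_cone_cmul hc hcn) hb hcnb
    -- The anticommutations turn alternativity into (cb)n = -c(bn) = b(cn), so the triple product is
    -- (cb)((cb)n) = -n.
    have h4 := associator_swap c b n
    rw [h3, h2, h1, cmul_neg, sub_eq_iff_eq_add] at h4
    have h5 : cmul b (cmul c n) = cmul (cmul c b) n := by
      rw [h1, h4]
      abel
    rw [h5, cmul_cmul_self ha ha1]

theorem exists_spin7_fix_cone_apply {v w : Cayley} (hv : ⟪cone, v⟫_ℝ = 0) (hw : ⟪cone, w⟫_ℝ = 0)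
    (hv1 : ‖v‖ = 1) (hw1 : ‖w‖ = 1) : ∃ g : spin7, g.1.2.1.1 cone = cone ∧ g.1.2.1.1 v = w := by
  classical
  have key : ∃ (c : Cayley) (r : ℝ), ⟪cone, c⟫_ℝ = 0 ∧ ‖c‖ = 1 ∧ v + w = r • c ∧
      ⟪c, v - w⟫_ℝ = 0 := by
    rcases eq_or_ne (v + w) 0 with h | h
    -- When w = -v the direction of v + w is undefined; any imaginary unit c orthogonal to v - w
    -- serves, with r = 0.
    · obtain ⟨c, hc, hcs⟩ :=
        exists_unit_orthogonal {cone, v - w} (Finset.card_le_two.trans_lt (by norm_num))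
      exact ⟨c, 0, hcs _ (by simp), hc, by rw [h, zero_smul],
        by rw [real_inner_comm]; exact hcs _ (by simp)⟩
    · have h0 : ‖v + w‖ ≠ 0 := norm_ne_zero_iff.2 h
      refine ⟨‖v + w‖⁻¹ • (v + w), ‖v + w‖, ?_, ?_, ?_, ?_⟩
      · rw [inner_smul_right, inner_add_right, hv, hw, add_zero, mul_zero]
      · rw [norm_smul, norm_inv, norm_norm, inv_mul_cancel₀ h0]
      · rw [smul_smul, mul_inv_cancel₀ h0, one_smul]
      · rw [real_inner_smul_left, (real_inner_add_sub_eq_zero_iff v w).2 (hv1.trans hw1.symm),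
          mul_zero]
  obtain ⟨c, r, hc, hc1, hvw, hcn⟩ := key
  obtain ⟨b, hb1, hbs⟩ := exists_unit_orthogonal {cone, c, v - w, cmul c (v - w)}
    (Finset.card_le_four.trans_lt (by norm_num))
  obtain ⟨g, hg1, hgc, hgn⟩ := exists_spin7_reflection (b := b) (c := c) (n := v - w)
    (hbs _ (by simp)) hc (by rw [inner_sub_right, hv, hw, sub_zero]) hb1 hc1 (hbs _ (by simp)) hcn
    (hbs _ (by simp)) (hbs _ (by simp))
  refine ⟨g, hg1, ?_⟩
  have h1 : v = (2⁻¹ : ℝ) • (r • c + (v - w)) := by rw [← hvw]; module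
  have h2 : w = (2⁻¹ : ℝ) • (r • c + -(v - w)) := by rw [← hvw]; module
  calc g.1.2.1.1 v = g.1.2.1.1 ((2⁻¹ : ℝ) • (r • c + (v - w))) := by rw [← h1]
    _ = w := by
      rw [LinearIsometryEquiv.map_smul, LinearIsometryEquiv.map_add, LinearIsometryEquiv.map_smul,
        hgc, hgn, ← h2]

/-- Both pairs are carried back to base point 1, where the stabilizer of 1 matches the second
vectors. -/
theorem exists_spin7_apply_orthonormal {p v q w : Cayley} (hp : ‖p‖ = 1) (hq : ‖q‖ = 1)
    (hv : ‖v‖ = 1) (hw : ‖w‖ = 1) (hpv : ⟪p, v⟫_ℝ = 0) (hqw : ⟪q, w⟫_ℝ = 0) :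
    ∃ g : spin7, g.1.2.1.1 p = q ∧ g.1.2.1.1 v = w := by
  obtain ⟨g, hg⟩ := exists_spin7_apply_cone hp
  obtain ⟨h, hh⟩ := exists_spin7_apply_cone hq
  have e1 : g.1.2.1.1.symm p = cone := by rw [← hg, LinearIsometryEquiv.symm_apply_apply]
  have e2 : h.1.2.1.1.symm q = cone := by rw [← hh, LinearIsometryEquiv.symm_apply_apply]
  obtain ⟨k, hk1, hk⟩ := exists_spin7_fix_cone_apply (v := g.1.2.1.1.symm v)
    (w := h.1.2.1.1.symm w) (by rw [← e1, LinearIsometryEquiv.inner_map_map, hpv])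
    (by rw [← e2, LinearIsometryEquiv.inner_map_map, hqw])
    (by rw [LinearIsometryEquiv.norm_map, hv]) (by rw [LinearIsometryEquiv.norm_map, hw])
  refine ⟨h * (k * g⁻¹), ?_, ?_⟩
  · change h.1.2.1.1 (k.1.2.1.1 (g.1.2.1.1.symm p)) = q
    rw [e1, hk1, hh]
  · change h.1.2.1.1 (k.1.2.1.1 (g.1.2.1.1.symm v)) = w
    rw [hk, LinearIsometryEquiv.apply_symm_apply]

/-! ### Linear isometries acting on the unit sphere -/

/-- The differential of the inclusion of `S⁷` into the Cayley numbers. -/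
def diffIncl (p : S7) : TangentSpace (𝓡 7) p →L[ℝ] Cayley :=
  mvfderiv (𝓡 7) (fun q : S7 => (q : Cayley)) p

theorem roundNorm_eq (v : TangentBundle (𝓡 7) S7) : roundNorm v = ‖diffIncl v.1 v.2‖ := rfl

theorem diffIncl_injective (p : S7) : Function.Injective (diffIncl p) :=
  injective_mvfderiv_subtypeVal_sphere p

theorem inner_diffIncl (p : S7) (v : TangentSpace (𝓡 7) p) : ⟪(p : Cayley), diffIncl p v⟫_ℝ = 0 := by
  have h : diffIncl p v ∈ (Submodule.span ℝ {(p : Cayley)})ᗮ := by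
    rw [← range_mvfderiv_subtypeVal (n := 7) p]
    exact ⟨v, rfl⟩
  exact Submodule.mem_orthogonal_singleton_iff_inner_right.1 h

theorem diffIncl_surjOn (p : S7) {y : Cayley} (hy : ⟪(p : Cayley), y⟫_ℝ = 0) :
    ∃ v, diffIncl p v = y := by
  have h : y ∈ (Submodule.span ℝ {(p : Cayley)})ᗮ :=
    Submodule.mem_orthogonal_singleton_iff_inner_right.2 hy
  rw [← range_mvfderiv_subtypeVal (n := 7) p] at h
  exact h

/-- The map of the unit sphere induced by a linear isometry. -/
def sphereMap (B : Cayley ≃ₗᵢ[ℝ] Cayley) (p : S7) : S7 :=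
  ⟨B p, by rw [mem_sphere_zero_iff_norm, B.norm_map]; exact mem_sphere_zero_iff_norm.1 p.2⟩

theorem contMDiff_sphereMap {m : ℕ∞ω} (B : Cayley ≃ₗᵢ[ℝ] Cayley) :
    ContMDiff (𝓡 7) (𝓡 7) m (sphereMap B) :=
  ContMDiff.codRestrict_sphere (f := fun p : S7 => B p)
    (B.contDiff.contMDiff.comp contMDiff_coe_sphere) fun p => (sphereMap B p).2

/-- Chain rule applied to the two factorizations ι ∘ `sphereMap B` = B ∘ ι, with B its own
derivative. -/
theorem diffIncl_tangentMap_sphereMap (B : Cayley ≃ₗᵢ[ℝ] Cayley) (v : TangentBundle (𝓡 7) S7) :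
    diffIncl (sphereMap B v.1) (tangentMap (𝓡 7) (𝓡 7) (sphereMap B) v).2 =
      B (diffIncl v.1 v.2) := by
  have hι : ∀ p : S7, MDifferentiableAt (𝓡 7) 𝓘(ℝ, Cayley) (fun q : S7 => (q : Cayley)) p :=
    fun p => (contMDiff_coe_sphere (m := 1) p).mdifferentiableAt one_ne_zero
  have hB : MDifferentiableAt (𝓡 7) (𝓡 7) (sphereMap B) v.1 :=
    (contMDiff_sphereMap (m := 1) B v.1).mdifferentiableAt one_ne_zero
  have hB' : MDifferentiableAt 𝓘(ℝ, Cayley) 𝓘(ℝ, Cayley) B (v.1 : Cayley) :=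
    B.differentiable.differentiableAt.mdifferentiableAt
  have h1 := mfderiv_comp v.1 (hι (sphereMap B v.1)) hB
  have h2 := mfderiv_comp v.1 hB' (hι v.1)
  have h3 : mfderiv 𝓘(ℝ, Cayley) 𝓘(ℝ, Cayley) B (v.1 : Cayley) =
      (B.toContinuousLinearEquiv : Cayley →L[ℝ] Cayley) := by
    rw [mfderiv_eq_fderiv]
    exact B.toContinuousLinearEquiv.fderiv
  rw [h3] at h2
  have h4 := h1.symm.trans h2
  exact congrArg (fun T => T v.2) h4

theorem roundNorm_tangentMap_sphereMap (B : Cayley ≃ₗᵢ[ℝ] Cayley) (v : TangentBundle (𝓡 7) S7) :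
    roundNorm (tangentMap (𝓡 7) (𝓡 7) (sphereMap B) v) = roundNorm v := by
  rw [roundNorm_eq, roundNorm_eq, ← B.norm_map (diffIncl v.1 v.2),
    ← diffIncl_tangentMap_sphereMap]
  rfl

/-- A tangent vector is determined by its base point and its image in the Cayley numbers, which
reduces the action on tangent vectors to linear algebra. -/
theorem tangentMap_sphereMap_eq (B : Cayley ≃ₗᵢ[ℝ] Cayley) {v w : TangentBundle (𝓡 7) S7}
    (h1 : B v.1 = w.1) (h2 : B (diffIncl v.1 v.2) = diffIncl w.1 w.2) :
    tangentMap (𝓡 7) (𝓡 7) (sphereMap B) v = w := by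
  obtain ⟨q, w⟩ := w
  have hq : sphereMap B v.1 = q := Subtype.ext h1
  subst hq
  rw [← diffIncl_tangentMap_sphereMap] at h2
  have h3 := diffIncl_injective _ h2
  exact congrArg (TotalSpace.mk (sphereMap B v.1)) h3

/-! ### Invariant Finsler metrics -/

theorem FinslerMetric.toFun_zero (F : FinslerMetric (n := 7) S7) (p : S7) :
    F.toFun ⟨p, 0⟩ = 0 := by
  have h := F.homogeneous p 0 2 two_pos
  rw [smul_zero] at h
  linarith

theorem exists_roundNorm_eq_one : ∃ v : TangentBundle (𝓡 7) S7, v.2 ≠ 0 ∧ roundNorm v = 1 := by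
  obtain ⟨b, hb, hb1⟩ := exists_unit_orthogonal {cone} (by simp)
  let p : S7 := ⟨cone, mem_sphere_zero_iff_norm.2 norm_cone⟩
  obtain ⟨v, hv⟩ := diffIncl_surjOn p (hb1 cone (by simp))
  have h : roundNorm ⟨p, v⟩ = 1 := (congrArg norm hv).trans hb
  refine ⟨⟨p, v⟩, fun h0 => ?_, h⟩
  change v = 0 at h0
  rw [roundNorm_eq, h0, map_zero, norm_zero] at h
  exact zero_ne_one h

theorem FinslerMetric.eq_of_roundNorm_eq_one {F : FinslerMetric (n := 7) S7}
    (hF : ∀ g : spin7, F.PreservedBy (fun p : S7 => g • p)) {v w : TangentBundle (𝓡 7) S7}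
    (hv : roundNorm v = 1) (hw : roundNorm w = 1) : F.toFun v = F.toFun w := by
  obtain ⟨g, h1, h2⟩ := exists_spin7_apply_orthonormal (mem_sphere_zero_iff_norm.1 v.1.2)
    (mem_sphere_zero_iff_norm.1 w.1.2) hv hw (inner_diffIncl v.1 v.2) (inner_diffIncl w.1 w.2)
  have h := hF g v
  rw [← h]
  exact congrArg F.toFun (tangentMap_sphereMap_eq g.1.2.1.1 h1 h2)

/-- A `Spin(7)`-invariant Finsler metric is a multiple of the round norm, since `Spin(7)` is
transitive on the unit tangent vectors of `S⁷`. -/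
theorem FinslerMetric.exists_eq_mul_roundNorm {F : FinslerMetric (n := 7) S7}
    (hF : ∀ g : spin7, F.PreservedBy (fun p : S7 => g • p)) :
    ∃ r : ℝ, 0 < r ∧ ∀ v : TangentBundle (𝓡 7) S7, F.toFun v = r * roundNorm v := by
  obtain ⟨v₀, hv₀, h1⟩ := exists_roundNorm_eq_one
  refine ⟨F.toFun v₀, F.pos v₀.1 v₀.2 hv₀, ?_⟩
  rintro ⟨p, v⟩
  -- Nonzero vectors are rescaled to round norm 1; homogeneity covers only positive factors.
  rcases eq_or_ne v 0 with rfl | hv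
  · rw [F.toFun_zero, roundNorm_eq, map_zero, norm_zero, mul_zero]
  · have hpos : 0 < ‖diffIncl p v‖ :=
      norm_pos_iff.2 fun h => hv (diffIncl_injective p (h.trans (map_zero _).symm))
    have hn : roundNorm ⟨p, ‖diffIncl p v‖⁻¹ • v⟩ = 1 := by
      rw [roundNorm_eq, map_smul, norm_smul, norm_inv, norm_norm, inv_mul_cancel₀ hpos.ne']
    rw [FinslerMetric.eq_of_roundNorm_eq_one hF h1 hn, F.homogeneous p v _ (inv_pos.2 hpos),
      roundNorm_eq]
    field_simp

/-- The map of the sphere induced by a linear isometry, as a diffeomorphism. -/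
def sphereDiffeomorph (B : Cayley ≃ₗᵢ[ℝ] Cayley) : S7 ≃ₘ⟮𝓡 7, 𝓡 7⟯ S7 where
  toFun := sphereMap B
  invFun := sphereMap B.symm
  left_inv p := Subtype.ext (B.symm_apply_apply p)
  right_inv p := Subtype.ext (B.apply_symm_apply p)
  contMDiff_toFun := contMDiff_sphereMap B
  contMDiff_invFun := contMDiff_sphereMap B.symm

/-- The symmetry at `p` is the reflection in the line through `p`. -/
theorem FinslerMetric.isSymmetric_of_eq_mul_roundNorm {F : FinslerMetric (n := 7) S7} {r : ℝ}
    (h : ∀ v : TangentBundle (𝓡 7) S7, F.toFun v = r * roundNorm v) : F.IsSymmetric := by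
  intro p
  refine ⟨sphereDiffeomorph (Submodule.span ℝ {(p : Cayley)}).reflection, fun v => ?_,
    fun q => Subtype.ext (Submodule.reflection_reflection _ _), Subtype.ext
      (Submodule.reflection_mem_subspace_eq_self (Submodule.mem_span_singleton_self _)), ?_⟩
  · rw [h, h]
    exact congrArg (r * ·) (roundNorm_tangentMap_sphereMap _ v)
  -- The fixed points on the sphere are p and -p only, so removing -p isolates p.
  · have hne : p ≠ -p := ne_neg_of_mem_unit_sphere ℝ p
    have hopen : ∀ᶠ q in nhdsWithin p {p}ᶜ, q ≠ -p :=
      (continuous_id.tendsto p).mono_left nhdsWithin_le_nhds |>.eventually_ne hne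
    filter_upwards [hopen, self_mem_nhdsWithin] with q hq hqp hfix
    have hmem : (q : Cayley) ∈ Submodule.span ℝ {(p : Cayley)} :=
      (Submodule.reflection_eq_self_iff _).1 (congrArg Subtype.val hfix)
    obtain ⟨a, ha⟩ := Submodule.mem_span_singleton.1 hmem
    have hp1 : ‖(p : Cayley)‖ = 1 := mem_sphere_zero_iff_norm.1 p.2
    have hq1 : ‖(q : Cayley)‖ = 1 := mem_sphere_zero_iff_norm.1 q.2
    rw [← ha, norm_smul, hp1, mul_one, Real.norm_eq_abs] at hq1
    rcases eq_or_eq_neg_of_abs_eq hq1 with rfl | rfl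
    · exact hqp (Subtype.ext (by rw [← ha, one_smul]))
    · exact hq (Subtype.ext (by rw [← ha, neg_one_smul]; rfl))

/-! ### The round Riemannian metric -/

section Pullback

variable {V W : Type*} [NormedAddCommGroup V] [NormedSpace ℝ V] [NormedAddCommGroup W]
  [InnerProductSpace ℝ W]

/-- The pull-back of `r ^ 2` times the inner product under a linear map. -/
def pullbackInner (r : ℝ) (T : V →L[ℝ] W) : V →L[ℝ] V →L[ℝ] ℝ :=
  (r ^ 2) • ((ContinuousLinearMap.compL ℝ V W ℝ).flip T).comp
    ((show W →L[ℝ] W →L[ℝ] ℝ from innerSL ℝ).comp T)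

theorem pullbackInner_apply (r : ℝ) (T : V →L[ℝ] W) (v w : V) :
    pullbackInner r T v w = r ^ 2 * ⟪T v, T w⟫_ℝ := rfl

/-- T enters through two factors linear in T, joined by the bilinear composition. -/
theorem contDiff_pullbackInner {m : ℕ∞ω} (r : ℝ) :
    ContDiff ℝ m (pullbackInner (V := V) (W := W) r) := by
  have h1 : ContDiff ℝ m (fun T : V →L[ℝ] W =>
      (show W →L[ℝ] W →L[ℝ] ℝ from innerSL ℝ).comp T) := contDiff_const.clm_comp contDiff_id
  have h2 : ContDiff ℝ m (fun T : V →L[ℝ] W => (ContinuousLinearMap.compL ℝ V W ℝ).flip T) :=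
    (ContinuousLinearMap.isBoundedLinearMap _).contDiff
  exact (h2.clm_comp h1).const_smul (r ^ 2)

end Pullback

/-- `r ^ 2` times the round Riemannian metric. -/
def roundInner (r : ℝ) (p : S7) :
    TangentSpace (𝓡 7) p →L[ℝ] TangentSpace (𝓡 7) p →L[ℝ] ℝ :=
  pullbackInner (V := EuclideanSpace ℝ (Fin 7)) r (diffIncl p)

theorem roundInner_apply (r : ℝ) (p : S7) (v w : TangentSpace (𝓡 7) p) :
    roundInner r p v w = r ^ 2 * ⟪diffIncl p v, diffIncl p w⟫_ℝ := rfl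

/-- In the trivialization at p₀ the metric is `pullbackInner` of the coordinate expression of the
differential of the inclusion, which is smooth in p. -/
theorem contMDiff_roundInner (r : ℝ) :
    ContMDiff (𝓡 7) ((𝓡 7).prod 𝓘(ℝ, EuclideanSpace ℝ (Fin 7) →L[ℝ]
      EuclideanSpace ℝ (Fin 7) →L[ℝ] ℝ)) ∞
      (fun p : S7 => TotalSpace.mk' (EuclideanSpace ℝ (Fin 7) →L[ℝ]
        EuclideanSpace ℝ (Fin 7) →L[ℝ] ℝ) (E := fun p : S7 =>
        TangentSpace (𝓡 7) p →L[ℝ] TangentSpace (𝓡 7) p →L[ℝ] ℝ) p (roundInner r p)) := by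
  intro p₀
  rw [contMDiffAt_hom_bundle]
  refine ⟨contMDiffAt_id, ?_⟩
  have hD := ContMDiffAt.mfderiv_const (m := ∞) (n := ∞)
    ((contMDiff_coe_sphere (m := ∞) (n := 7) (E := Cayley)) p₀) le_rfl
  refine ((contDiff_pullbackInner r).contMDiff.contMDiffAt.comp p₀ hD).congr_of_eventuallyEq ?_
  filter_upwards [(trivializationAt (EuclideanSpace ℝ (Fin 7)) (TangentSpace (𝓡 7) (M := S7))
    p₀).open_baseSet.mem_nhds (mem_baseSet_trivializationAt _ _ p₀)] with p hp
  ext v w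
  rw [inCoordinates_apply_eq₂ hp hp (Set.mem_univ _)]
  have key : ∀ u : EuclideanSpace ℝ (Fin 7), inTangentCoordinates (𝓡 7) 𝓘(ℝ, Cayley) id
      (fun q : S7 => (q : Cayley)) (fun p => mfderiv (𝓡 7) 𝓘(ℝ, Cayley) (fun q : S7 => (q : Cayley)) p)
      p₀ p u = diffIncl p ((trivializationAt (EuclideanSpace ℝ (Fin 7))
        (TangentSpace (𝓡 7) (M := S7)) p₀).symm p u) := by
    intro u
    rw [← Trivialization.symmL_apply (R := ℝ) _ hp]
    change ((trivializationAt Cayley (TangentSpace 𝓘(ℝ, Cayley)) (p₀ : Cayley)).continuousLinearMapAt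
      ℝ (p : Cayley)) (diffIncl p _) = _
    rw [TangentBundle.continuousLinearMapAt_model_space]
    rfl
  simp only [Function.comp_apply, pullbackInner_apply, key, roundInner_apply]
  simp

theorem FinslerMetric.isRiemannian_of_eq_mul_roundNorm {F : FinslerMetric (n := 7) S7} {r : ℝ}
    (hr : 0 < r) (h : ∀ v : TangentBundle (𝓡 7) S7, F.toFun v = r * roundNorm v) :
    F.IsRiemannian := by
  have hpos : ∀ (p : S7) (v : TangentSpace (𝓡 7) p), v ≠ 0 → 0 < roundInner r p v v := by
    intro p v hv
    rw [roundInner_apply]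
    exact mul_pos (by positivity) (real_inner_self_pos.2 fun h0 =>
      hv (diffIncl_injective p (h0.trans (map_zero _).symm)))
  refine ⟨⟨roundInner r, fun p v w => ?_, hpos, fun p => ?_, contMDiff_roundInner r⟩,
    fun p v => ?_⟩
  · rw [roundInner_apply, roundInner_apply, real_inner_comm]
  -- An injective linear map on a finite-dimensional space is bounded below, so the unit ball of the
  -- metric lies in the Euclidean ball of radius K / r.
  · obtain ⟨K, hK, hKb⟩ := LinearMap.exists_antilipschitzWith
      ((show EuclideanSpace ℝ (Fin 7) →L[ℝ] Cayley from diffIncl p) :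
        EuclideanSpace ℝ (Fin 7) →ₗ[ℝ] Cayley)
      (LinearMap.ker_eq_bot.2 (diffIncl_injective p))
    refine NormedSpace.isVonNBounded_of_isBounded (E := EuclideanSpace ℝ (Fin 7)) ℝ
      ((Metric.isBounded_ball (x := (0 : EuclideanSpace ℝ (Fin 7))) (r := K * r⁻¹)).subset ?_)
    intro v hv
    have h1 : r ^ 2 * ⟪diffIncl p v, diffIncl p v⟫_ℝ < 1 := hv
    rw [real_inner_self_eq_norm_sq, ← mul_pow, sq_lt_one_iff₀ (by positivity),
      ← lt_inv_mul_iff₀ hr, mul_one] at h1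
    have h3 : ‖v‖ ≤ K * ‖diffIncl p v‖ := by
      simpa using! hKb.le_mul_dist v 0
    exact mem_ball_zero_iff.2 (h3.trans_lt (mul_lt_mul_of_pos_left h1 hK))
  · change _ = Real.sqrt (roundInner r p v v)
    rw [h, roundNorm_eq, roundInner_apply, real_inner_self_eq_norm_sq, ← mul_pow,
      Real.sqrt_sq (by positivity)]

end FinslerSphere

end
theorem proposition5p1
    (F : FinslerSphere.FinslerMetric (n := 7) FinslerSphere.S7)
    (hF : ∀ g : FinslerSphere.spin7, F.PreservedBy (fun p : FinslerSphere.S7 => g • p))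
    (hX : ∃ X : FinslerSphere.lieSpin7, X.1 ≠ 0 ∧
      ∃ c : ℝ, ∀ p : FinslerSphere.S7, F.toFun (FinslerSphere.fundamentalVector X p) = c) :
    F.IsRiemannian ∧ F.IsSymmetric ∧
      ∃ r : ℝ, 0 < r ∧
        ∀ v : TangentBundle (𝓡 7) FinslerSphere.S7, F.toFun v = r * FinslerSphere.roundNorm v := by
  obtain ⟨r, hr, h⟩ := FinslerSphere.FinslerMetric.exists_eq_mul_roundNorm hF
  exact ⟨FinslerSphere.FinslerMetric.isRiemannian_of_eq_mul_roundNorm hr h,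
    FinslerSphere.FinslerMetric.isSymmetric_of_eq_mul_roundNorm h, r, hr, h⟩
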